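/- Let $q,a,b,c\in\mathbb{C}$ with $|q|<1$, $a,b,c\neq 0$ and $|c/ab|<1$, and suppose that no denominator below vanishes, that is, $cq^m\neq 1$ for all integers $m\ge 0$ and $(ab/c)\,q^m\neq 1$ for all integers $m\ge 1$. Write $(x;q)_n=\prod_{k=0}^{n-1}(1-xq^k)$, $(x;q)_\infty=\prod_{k=0}^{\infty}(1-xq^k)$ and $(x_1,\dots,x_r;q)_n=\prod_{i=1}^r(x_i;q)_n$ for $n\in\{0,1,2,\dots\}\cup\{\infty\}$. Then the three series below converge absolutely and $$\sum_{n=0}^{\infty}n\,\frac{(a,b;q)_n}{(q,c;q)_n}\Big(\frac{c}{ab}\Big)^n=-\frac{(c/a,c/b;q)_\infty}{(c,c/(ab);q)_\infty}\sum_{n=1}^{\infty}\frac{(a,b;q)_n}{(qab/c;q)_n}\,\frac{q^n}{1-q^n}-\frac{(a,b,q;q)_\infty}{(c,ab/c,cq/(ab);q)_\infty}\sum_{n=0}^{\infty}\frac{(c/a,c/b;q)_n}{(q;q)_n}\,\frac{q^n}{1-cq^n/(ab)}.$$ -/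

import Mathlib

/-- The finite `q`-shifted factorial `(a; q)_n = (1 - a) (1 - a q) ⋯ (1 - a q ^ (n - 1))`. -/
noncomputable def qPoch (a q : ℂ) (n : ℕ) : ℂ :=
  ∏ k ∈ Finset.range n, (1 - a * q ^ k)

/-- The infinite `q`-shifted factorial `(a; q)_∞ = ∏_{k ≥ 0} (1 - a q ^ k)`, for `|q| < 1`. -/
noncomputable def qPochInf (a q : ℂ) : ℂ :=
  ∏' k : ℕ, (1 - a * q ^ k)

/-- The product that defines `(a; q)_∞` converges for `|q| < 1`. -/
theorem multipliable_qPochInf (a : ℂ) {q : ℂ} (hq : ‖q‖ < 1) :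
    Multipliable fun k : ℕ => 1 - a * q ^ k := by
  have h : Summable fun k : ℕ => ‖-(a * q ^ k)‖ := by
    simp only [norm_neg, norm_mul, norm_pow]
    exact (summable_geometric_of_lt_one (norm_nonneg q) hq).mul_left _
  simpa [sub_eq_add_neg] using multipliable_one_add_of_summable h

/-- The relation `(a; q)_n (a q ^ n; q)_∞ = (a; q)_∞` between the two factorials. -/
theorem qPoch_mul_qPochInf (a : ℂ) {q : ℂ} (hq : ‖q‖ < 1) (n : ℕ) :
    qPoch a q n * qPochInf (a * q ^ n) q = qPochInf a q := by
  have h : Multipliable fun k : ℕ => 1 - a * q ^ (k + n) := by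
    have := multipliable_qPochInf (a * q ^ n) hq
    simpa [pow_add, mul_assoc, mul_comm, mul_left_comm] using this
  have e := Multipliable.prod_mul_tprod_nat_mul' (f := fun k : ℕ => 1 - a * q ^ k) h
  rw [qPoch, qPochInf, qPochInf, ← e]
  congr 1
  refine tprod_congr fun k => ?_
  ring

/-!
The series on the left is the first moment of the terms of `₂φ₁(a, b; c; q, z)` at the point
`z = c / (a b)`. Write `c = a b z`, so that `c / a = b z`, `c / b = a z` and `a b / c = 1 / z`.

For `q ≠ 0` the proof expands `(a, b; q)_k (c q ^ k; q)_∞ z ^ k / (q; q)_k` as the sum of two series,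
one in `(a, b; q)_n` and one in `(a z, b z; q)_n`, in which `k` occurs only through the weight
`qKernel u q k = u ^ k (1 / u; q)_k / (q; q)_k` with `u = q ^ n` or `u = z q ^ n`
(`vandermondeSeries_add_dual_weighted`). For `k = 0` this is the nonterminating `q`-Chu–Vandermonde
sum (`vandermondeSeries_add_dual`): each series satisfies an inhomogeneous first-order
`q`-difference equation in `a`, since the relevant difference telescopes, and the inhomogeneous
terms of the two cancel. The step from `k` to `k + 1` replaces `(a, b, z)` by
`(a q, b q, z / q)`.

Multiplying by `k` and summing over `k`, the two summations may be exchanged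
(`hasSum_nat_mul_vandermondeSeries`), and the inner sums are first moments of the kernel:
`∑ k, k * qKernel u q k = -(q; q)_∞ / (u; q)_∞` for `|u| < 1` (`tsum_nat_mul_qKernel`), and `0` for
`u = 1`. This gives the two series on the right. The case `q = 0`, in which `z / q` makes no sense,
is elementary.
-/

open Filter Topology

/-! ### Elementary properties of the `q`-shifted factorials -/


@[simp] lemma qPoch_zero (a q : ℂ) : qPoch a q 0 = 1 := by simp [qPoch]

lemma qPoch_succ (a q : ℂ) (n : ℕ) : qPoch a q (n + 1) = qPoch a q n * (1 - a * q ^ n) := by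
  simp [qPoch, Finset.prod_range_succ]

lemma qPoch_succ' (a q : ℂ) (n : ℕ) : qPoch a q (n + 1) = (1 - a) * qPoch (a * q) q n := by
  simp only [qPoch, Finset.prod_range_succ', pow_zero, mul_one]
  rw [mul_comm]
  congr 1
  exact Finset.prod_congr rfl fun k _ => by ring

lemma qPoch_mul_one_sub (a q : ℂ) (n : ℕ) :
    (1 - a) * qPoch (a * q) q n = qPoch a q n * (1 - a * q ^ n) := by
  rw [← qPoch_succ', qPoch_succ]

@[simp] lemma qPoch_zero_left (q : ℂ) (n : ℕ) : qPoch 0 q n = 1 := by simp [qPoch]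

@[simp] lemma qPochInf_zero_left (q : ℂ) : qPochInf 0 q = 1 := by simp [qPochInf]

lemma qPochInf_eq_one_sub_mul (a : ℂ) {q : ℂ} (hq : ‖q‖ < 1) :
    qPochInf a q = (1 - a) * qPochInf (a * q) q := by
  have := qPoch_mul_qPochInf a hq 1
  rw [qPoch_succ] at this
  simpa using this.symm

@[simp] lemma qPochInf_one {q : ℂ} (hq : ‖q‖ < 1) : qPochInf 1 q = 0 := by
  rw [qPochInf_eq_one_sub_mul 1 hq]; simp

lemma qPoch_one_succ (q : ℂ) (n : ℕ) : qPoch 1 q (n + 1) = 0 := by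
  rw [qPoch_succ']; simp

lemma qPoch_ne_zero {a q : ℂ} (h : ∀ m : ℕ, a * q ^ m ≠ 1) (n : ℕ) : qPoch a q n ≠ 0 :=
  Finset.prod_ne_zero_iff.2 fun k _ => sub_ne_zero.2 (h k).symm

lemma summable_norm_mul_pow (a : ℂ) {q : ℂ} (hq : ‖q‖ < 1) :
    Summable fun k : ℕ => ‖-(a * q ^ k)‖ := by
  simp only [norm_neg, norm_mul, norm_pow]
  exact (summable_geometric_of_lt_one (norm_nonneg q) hq).mul_left _

lemma qPochInf_ne_zero {a q : ℂ} (hq : ‖q‖ < 1) (h : ∀ m : ℕ, a * q ^ m ≠ 1) :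
    qPochInf a q ≠ 0 := by
  have := tprod_one_add_ne_zero_of_summable (f := fun k : ℕ => -(a * q ^ k))
    (fun k => by rw [← sub_eq_add_neg]; exact sub_ne_zero.2 (h k).symm)
    (summable_norm_mul_pow a hq)
  simpa [qPochInf, sub_eq_add_neg] using this

lemma mul_pow_ne_one {u q : ℂ} (hq : ‖q‖ < 1) (hu : ‖u‖ < 1) (m : ℕ) : u * q ^ m ≠ 1 := by
  intro h
  have h1 : ‖u * q ^ m‖ < 1 := by
    rw [norm_mul, norm_pow]
    exact mul_lt_one_of_nonneg_of_lt_one_left (norm_nonneg _) hu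
      (pow_le_one₀ (norm_nonneg _) hq.le)
  simp [h] at h1

lemma qPoch_self_ne_zero {q : ℂ} (hq : ‖q‖ < 1) (n : ℕ) : qPoch q q n ≠ 0 :=
  qPoch_ne_zero (mul_pow_ne_one hq hq) n

lemma one_sub_pow_succ_ne_zero {q : ℂ} (hq : ‖q‖ < 1) (n : ℕ) : 1 - q ^ (n + 1) ≠ 0 := by
  rw [pow_succ']
  exact sub_ne_zero.2 (mul_pow_ne_one hq hq n).symm

lemma tendsto_qPoch (a : ℂ) {q : ℂ} (hq : ‖q‖ < 1) :
    Tendsto (qPoch a q) atTop (𝓝 (qPochInf a q)) :=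
  (multipliable_qPochInf a hq).hasProd.tendsto_prod_nat

lemma prod_one_add_mul_pow_le {x r : ℝ} (hx : 0 ≤ x) (hr : 0 ≤ r) (hr1 : r < 1) (n : ℕ) :
    ∏ k ∈ Finset.range n, (1 + x * r ^ k) ≤ Real.exp (x / (1 - r)) := by
  have hs := (summable_geometric_of_lt_one hr hr1).mul_left x
  refine (Real.prod_one_add_le_exp_sum _ fun k => by positivity).trans (Real.exp_le_exp.2 ?_)
  refine (hs.sum_le_tsum _ fun k _ => by positivity).trans_eq ?_
  rw [tsum_mul_left, tsum_geometric_of_lt_one hr hr1, div_eq_mul_inv]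

lemma norm_qPoch_le (a : ℂ) {q : ℂ} (hq : ‖q‖ < 1) (n : ℕ) :
    ‖qPoch a q n‖ ≤ Real.exp (‖a‖ / (1 - ‖q‖)) := by
  rw [qPoch, norm_prod]
  exact (Finset.prod_le_prod (fun _ _ => norm_nonneg _) fun k _ =>
    (norm_sub_le _ _).trans_eq (by simp)).trans
    (prod_one_add_mul_pow_le (norm_nonneg a) (norm_nonneg q) hq n)

lemma exists_norm_inv_qPoch_le {a q : ℂ} (hq : ‖q‖ < 1) (h : ∀ m : ℕ, a * q ^ m ≠ 1) :
    ∃ C : ℝ, 0 < C ∧ ∀ n, ‖(qPoch a q n)⁻¹‖ ≤ C := by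
  have ht := (tendsto_qPoch a hq).inv₀ (qPochInf_ne_zero hq h)
  obtain ⟨C, hC⟩ := ht.norm.bddAbove_range
  refine ⟨max C 1, by positivity, fun n => le_max_of_le_left (hC ⟨n, rfl⟩)⟩

lemma continuous_qPochInf {q : ℂ} (hq : ‖q‖ < 1) : Continuous fun a => qPochInf a q := by
  refine continuous_iff_continuousAt.2 fun a => ?_
  have hs := (summable_geometric_of_lt_one (norm_nonneg q) hq).mul_left (‖a‖ + 1)
  have := tendsto_tprod_one_add_of_dominated_convergence (𝓕 := 𝓝 a)
    (f := fun x (k : ℕ) => -(x * q ^ k)) (g := fun k => -(a * q ^ k)) hs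
    (fun k => (Continuous.tendsto (by fun_prop) a))
    (by
      filter_upwards [(continuous_norm.tendsto a).eventually_lt_const (lt_add_one ‖a‖)] with x hx k
      rw [norm_neg, norm_mul, norm_pow]
      gcongr)
  simpa only [ContinuousAt, qPochInf, sub_eq_add_neg] using this

lemma continuous_qPoch (q : ℂ) (n : ℕ) : Continuous fun a => qPoch a q n := by
  unfold qPoch
  fun_prop

/-- A function that is continuous at `0` and satisfies `f a = (1 - a w) f (a q)` is a multiple of
`(a w; q)_∞`. -/
lemma eq_qPochInf_mul_of_functional_eq {q : ℂ} (hq : ‖q‖ < 1) {f : ℂ → ℂ} {w : ℂ}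
    (hf : ContinuousAt f 0) (h : ∀ a, f a = (1 - a * w) * f (a * q)) (a : ℂ) :
    f a = qPochInf (a * w) q * f 0 := by
  have h1 : ∀ N : ℕ, f a = qPoch (a * w) q N * f (a * q ^ N) := by
    intro N
    induction N with
    | zero => simp
    | succ N ih =>
      rw [ih, h (a * q ^ N), qPoch_succ]
      ring_nf
  have h2 : Tendsto (fun N : ℕ => a * q ^ N) atTop (𝓝 0) := by
    simpa using (tendsto_pow_atTop_nhds_zero_of_norm_lt_one hq).const_mul a
  refine tendsto_nhds_unique tendsto_const_nhds
    (((tendsto_qPoch (a * w) hq).mul (hf.tendsto.comp h2)).congr fun N => (h1 N).symm)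

/-- The coefficients `(a, b; q)_n / (q, e; q)_n` of a `₂φ₁` series are bounded, uniformly for `a` in
a disc; the uniformity serves the continuity in `a`. -/
lemma exists_norm_coeff_le (a b : ℂ) {e q : ℂ} (hq : ‖q‖ < 1) (he : ∀ m : ℕ, e * q ^ m ≠ 1) :
    ∃ C : ℝ, 0 < C ∧ ∀ a', ‖a'‖ ≤ ‖a‖ → ∀ n,
      ‖qPoch a' q n * qPoch b q n / (qPoch q q n * qPoch e q n)‖ ≤ C := by
  obtain ⟨C₁, h1, hC₁⟩ := exists_norm_inv_qPoch_le hq (mul_pow_ne_one hq hq)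
  obtain ⟨C₂, h2, hC₂⟩ := exists_norm_inv_qPoch_le hq he
  refine ⟨Real.exp (‖a‖ / (1 - ‖q‖)) * Real.exp (‖b‖ / (1 - ‖q‖)) * (C₁ * C₂), by positivity,
    fun a' ha' n => ?_⟩
  rw [div_eq_mul_inv, mul_inv, norm_mul, norm_mul, norm_mul]
  have hq' : 0 < 1 - ‖q‖ := by linarith
  have := norm_qPoch_le b hq n
  have h3 : ‖qPoch a' q n‖ ≤ Real.exp (‖a‖ / (1 - ‖q‖)) :=
    (norm_qPoch_le a' hq n).trans (by gcongr)
  have := hC₁ n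
  have := hC₂ n
  gcongr

/-! ### The nonterminating `q`-Chu–Vandermonde sum -/

lemma summable_coeff_mul_pow (a b : ℂ) {e q : ℂ} (hq : ‖q‖ < 1) (he : ∀ m : ℕ, e * q ^ m ≠ 1) :
    Summable fun n : ℕ =>
      qPoch a q n * qPoch b q n / (qPoch q q n * qPoch e q n) * q ^ n := by
  obtain ⟨C, -, hC⟩ := exists_norm_coeff_le a b hq he
  refine Summable.of_norm_bounded
    ((summable_geometric_of_lt_one (norm_nonneg q) hq).mul_left C) fun n => ?_
  rw [norm_mul, norm_pow]
  have := hC a le_rfl n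
  gcongr

/-- The contiguous relation in `a` for the `₂φ₁` series with argument `q`. It holds because the
difference of the two series telescopes. -/
lemma contiguous_tsum_coeff (a b : ℂ) {z q : ℂ} (hq : ‖q‖ < 1) (hz : z ≠ 0)
    (he : ∀ m : ℕ, q / z * q ^ m ≠ 1) :
    (1 - a * z) * (∑' n : ℕ, qPoch a q n * qPoch b q n / (qPoch q q n * qPoch (q / z) q n) * q ^ n)
      - (1 - a * b * z) *
        (∑' n : ℕ, qPoch (a * q) q n * qPoch b q n / (qPoch q q n * qPoch (q / z) q n) * q ^ n) =
      -(a * z) * (qPochInf (a * q) q * qPochInf b q / (qPochInf q q * qPochInf (q / z) q)) := by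
  have hs1 := (summable_coeff_mul_pow a b hq he).hasSum.mul_left (1 - a * z)
  have hs2 := (summable_coeff_mul_pow (a * q) b hq he).hasSum.mul_left (1 - a * b * z)
  have hs := (hs1.sub hs2).tendsto_sum_nat
  refine tendsto_nhds_unique ((tendsto_add_atTop_iff_nat 1).2 hs) ?_
  -- the closed form of the partial sums of the difference, and its limit
  have ht : Tendsto (fun N : ℕ => -(a * z) * (qPoch (a * q) q N * qPoch b q (N + 1) /
      (qPoch q q N * qPoch (q / z) q N))) atTop
      (𝓝 (-(a * z) * (qPochInf (a * q) q * qPochInf b q /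
        (qPochInf q q * qPochInf (q / z) q)))) :=
    (((tendsto_qPoch (a * q) hq).mul ((tendsto_add_atTop_iff_nat 1).2 (tendsto_qPoch b hq))).div
      ((tendsto_qPoch q hq).mul (tendsto_qPoch (q / z) hq))
      (mul_ne_zero (qPochInf_ne_zero hq (mul_pow_ne_one hq hq))
        (qPochInf_ne_zero hq he))).const_mul _
  refine ht.congr fun N => ?_
  induction N with
  | zero => simp [qPoch_succ]; ring
  | succ N ih =>
    rw [Finset.sum_range_succ, ← ih]
    have h1 := qPoch_self_ne_zero hq N
    have h2 := qPoch_ne_zero he N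
    have h3 := one_sub_pow_succ_ne_zero hq N
    have h4 : z - q * q ^ N ≠ 0 := by
      intro h
      apply he N
      rw [div_mul_eq_mul_div, div_eq_one_iff_eq hz]
      exact (sub_eq_zero.1 h).symm
    have h5 : 1 - q / z * q ^ N ≠ 0 := sub_ne_zero.2 (he N).symm
    have e5 : 1 - q / z * q ^ N = (z - q * q ^ N) / z := by field_simp
    rw [qPoch_succ b q (N + 1), qPoch_succ' a q N, qPoch_succ (a * q) q N, qPoch_succ q q N,
      qPoch_succ (q / z) q N, e5]
    rw [pow_succ] at h3 ⊢
    rw [mul_comm q (q ^ N)] at h4 ⊢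
    generalize qPoch q q N = Q at *
    generalize qPoch (q / z) q N = E at *
    generalize qPoch (a * q) q N = A
    generalize qPoch b q (N + 1) = B
    generalize q ^ N = x at *
    clear h5 e5
    obtain ⟨D, hD⟩ : ∃ D, D = 1 - x * q := ⟨_, rfl⟩
    obtain ⟨W, hW⟩ : ∃ W, W = z - x * q := ⟨_, rfl⟩
    rw [← hD] at h3 ⊢
    rw [← hW] at h4 ⊢
    field_simp
    rw [hD, hW]
    ring

/-- `q ^ k` is a zero of `qKernel u q` for `k` large; in general `qKernel u q k` is
`u ^ k (1 / u; q)_k / (q; q)_k`, in a form that makes sense also for `u = 0`. -/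
noncomputable def qKernel (u q : ℂ) (k : ℕ) : ℂ :=
  ∏ j ∈ Finset.range k, (u - q ^ j) / (1 - q ^ (j + 1))

@[simp] lemma qKernel_zero (u q : ℂ) : qKernel u q 0 = 1 := by simp [qKernel]

lemma qKernel_succ (u q : ℂ) (k : ℕ) :
    qKernel u q (k + 1) = qKernel u q k * ((u - q ^ k) / (1 - q ^ (k + 1))) := by
  rw [qKernel, Finset.prod_range_succ, ← qKernel]

lemma qKernel_mul_succ (u : ℂ) {q : ℂ} (hq : ‖q‖ < 1) (k : ℕ) :
    qKernel (u * q) q (k + 1) = (u * q - 1) * q ^ k / (1 - q ^ (k + 1)) * qKernel u q k := by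
  induction k with
  | zero => simp [qKernel]
  | succ k ih =>
    rw [qKernel_succ, ih, qKernel_succ]
    have := one_sub_pow_succ_ne_zero hq k
    have := one_sub_pow_succ_ne_zero hq (k + 1)
    field_simp
    ring

lemma qKernel_one_succ (q : ℂ) (k : ℕ) : qKernel 1 q (k + 1) = 0 := by
  refine Finset.prod_eq_zero (i := 0) (by simp) (by simp)

/-- One of the two dual series of the nonterminating `q`-Chu–Vandermonde sum, with its prefactor
and with the weight `qKernel (y q ^ n) q k` at the `n`-th term. The dual series has the
parameters `a z`, `b z`, `1 / z`. -/
noncomputable def vandermondeSeries (q a b z y : ℂ) (k : ℕ) : ℂ :=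
  qPochInf (a * z) q * qPochInf (b * z) q / qPochInf z q *
    ∑' n : ℕ, qPoch a q n * qPoch b q n / (qPoch q q n * qPoch (q / z) q n) * q ^ n *
      qKernel (y * q ^ n) q k

lemma vandermondeSeries_comm (q a b z y : ℂ) (k : ℕ) :
    vandermondeSeries q a b z y k = vandermondeSeries q b a z y k := by
  unfold vandermondeSeries
  rw [mul_comm (qPochInf (a * z) q)]
  simp only [mul_comm (qPoch a q _)]

lemma vandermondeSeries_contiguous (a b y : ℂ) {z q : ℂ} (hq : ‖q‖ < 1) (hz : z ≠ 0)
    (he : ∀ m : ℕ, q / z * q ^ m ≠ 1) (hz' : ∀ m : ℕ, z * q ^ m ≠ 1) :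
    vandermondeSeries q a b z y 0 - (1 - a * b * z) * vandermondeSeries q (a * q) b z y 0 =
      -(a * z) / (1 - z) * (qPochInf (a * z * q) q * qPochInf (b * z) q * qPochInf (a * q) q *
        qPochInf b q / (qPochInf (z * q) q * qPochInf (q / z) q * qPochInf q q)) := by
  have h := contiguous_tsum_coeff a b hq hz he
  have h1 : 1 - z ≠ 0 := sub_ne_zero.2 (by simpa using (hz' 0).symm)
  have h2 : qPochInf (z * q) q ≠ 0 := qPochInf_ne_zero hq fun m => by
    simpa [pow_succ', mul_assoc] using hz' (m + 1)
  have h3 := qPochInf_ne_zero hq he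
  have h4 := qPochInf_ne_zero hq (mul_pow_ne_one hq hq)
  simp only [vandermondeSeries, qKernel_zero, mul_one]
  rw [qPochInf_eq_one_sub_mul (a * z) hq, qPochInf_eq_one_sub_mul z hq,
    show a * q * z = a * z * q by ring]
  generalize (∑' n : ℕ, qPoch a q n * qPoch b q n / (qPoch q q n * qPoch (q / z) q n) * q ^ n) = S
    at *
  generalize (∑' n : ℕ, qPoch (a * q) q n * qPoch b q n / (qPoch q q n * qPoch (q / z) q n) *
    q ^ n) = S' at *
  have e : (1 - a * z) * qPochInf (a * z * q) q * qPochInf (b * z) q /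
        ((1 - z) * qPochInf (z * q) q) * S -
      (1 - a * b * z) * (qPochInf (a * z * q) q * qPochInf (b * z) q /
        ((1 - z) * qPochInf (z * q) q) * S') =
      qPochInf (a * z * q) q * qPochInf (b * z) q / ((1 - z) * qPochInf (z * q) q) *
        ((1 - a * z) * S - (1 - a * b * z) * S') := by ring
  rw [e, h]
  field_simp

lemma continuousAt_vandermondeSeries (b y : ℂ) {z q : ℂ} (hq : ‖q‖ < 1)
    (he : ∀ m : ℕ, q / z * q ^ m ≠ 1) :
    ContinuousAt (fun a => vandermondeSeries q a b z y 0) 0 := by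
  simp only [vandermondeSeries, qKernel_zero, mul_one]
  have hc := continuous_qPochInf hq
  refine ContinuousAt.mul (Continuous.continuousAt (by fun_prop)) ?_
  obtain ⟨C, -, hC⟩ := exists_norm_coeff_le 1 b hq he
  refine tendsto_tsum_of_dominated_convergence
    ((summable_geometric_of_lt_one (norm_nonneg q) hq).mul_left C) (fun n => ?_) ?_
  · have := continuous_qPoch q n
    exact Continuous.tendsto (by fun_prop) 0
  · filter_upwards [Metric.ball_mem_nhds (0 : ℂ) one_pos] with a ha n
    rw [norm_mul, norm_pow]
    have := hC a (by simpa using (mem_ball_zero_iff.1 ha).le) n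
    gcongr

lemma vandermondeSeries_one_zero (y : ℂ) {z q : ℂ} (hq : ‖q‖ < 1)
    (hz' : ∀ m : ℕ, z * q ^ m ≠ 1) : vandermondeSeries q 1 0 z y 0 = 1 := by
  have h := qPochInf_ne_zero hq hz'
  simp only [vandermondeSeries, qKernel_zero, mul_one]
  rw [tsum_eq_single 0]
  · simp [h]
  · intro n hn
    obtain ⟨n, rfl⟩ := Nat.exists_eq_succ_of_ne_zero hn
    simp [qPoch_one_succ]

/-- The nonterminating `q`-Chu–Vandermonde sum. Both sides satisfy `f a = (1 - a b z) f (a q)`, and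
so only the case `a = 0` is left; by symmetry it reduces to `a = 1`, `b = 0`. -/
lemma vandermondeSeries_add_dual {z q : ℂ} (a b y y' : ℂ) (hq : ‖q‖ < 1) (hz : z ≠ 0)
    (he : ∀ m : ℕ, q / z * q ^ m ≠ 1) (hz' : ∀ m : ℕ, z * q ^ m ≠ 1)
    (hi : ∀ m : ℕ, z⁻¹ * q ^ m ≠ 1) :
    vandermondeSeries q a b z y 0 + vandermondeSeries q (a * z) (b * z) z⁻¹ y' 0 =
      qPochInf (a * b * z) q := by
  have he' : ∀ m : ℕ, q / z⁻¹ * q ^ m ≠ 1 := fun m => by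
    rw [div_inv_eq_mul]
    simpa [pow_succ', mul_assoc, mul_comm, mul_left_comm] using hz' (m + 1)
  -- in `hrec` the inhomogeneous terms of the two contiguous relations cancel
  set L : ℂ → ℂ → ℂ := fun a b =>
    vandermondeSeries q a b z y 0 + vandermondeSeries q (a * z) (b * z) z⁻¹ y' 0 with hL
  have hrec : ∀ a b, L a b = (1 - a * (b * z)) * L (a * q) b := by
    intro a b
    have e1 := vandermondeSeries_contiguous a b y hq hz he hz'
    have e2 := vandermondeSeries_contiguous (a * z) (b * z) y' hq (inv_ne_zero hz) he' hi
    have h1 : 1 - z ≠ 0 := sub_ne_zero.2 (by simpa using (hz' 0).symm)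
    have h2 : z - 1 ≠ 0 := by rw [← neg_sub]; exact neg_ne_zero.2 h1
    have e3 : 1 - z⁻¹ = (z - 1) / z := by field_simp
    rw [mul_inv_cancel_right₀ hz, mul_inv_cancel_right₀ hz, e3, div_inv_eq_mul,
      show a * z * (b * z) * z⁻¹ = a * b * z by field_simp, show z⁻¹ * q = q / z by ring,
      mul_comm q z] at e2
    rw [show a * z * q = a * q * z by ring] at e1 e2
    have key : -(a * z) / (1 - z) = -(-a / ((z - 1) / z)) := by
      rw [show 1 - z = -(z - 1) by ring]
      field_simp
    rw [key] at e1
    simp only [hL]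
    linear_combination e1 + e2
  have hcont : ∀ b, ContinuousAt (fun a => L a b) 0 := by
    intro b
    refine (continuousAt_vandermondeSeries b y hq he).add ?_
    refine ContinuousAt.comp (f := fun a : ℂ => a * z)
      (g := fun a => vandermondeSeries q a (b * z) z⁻¹ y' 0) ?_
      (Continuous.continuousAt (by fun_prop))
    rw [zero_mul]
    exact continuousAt_vandermondeSeries (b * z) y' hq he'
  have hsymm : ∀ a b, L a b = L b a := fun a b => by
    simp only [hL]
    rw [vandermondeSeries_comm, vandermondeSeries_comm q (a * z)]
  have hsol : ∀ a b, L a b = qPochInf (a * (b * z)) q * L 0 b := fun a b =>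
    eq_qPochInf_mul_of_functional_eq hq (hcont b) (fun a => hrec a b) a
  have h10 : L 1 0 = 1 := by
    simp only [hL]
    rw [vandermondeSeries_one_zero y hq hz']
    simp [vandermondeSeries, hz, hq]
  have h00 : L 0 0 = 1 := by
    have := hsol 1 0
    simp only [zero_mul, mul_zero, qPochInf_zero_left, one_mul] at this
    rw [← this, h10]
  have h0 : L 0 b = 1 := by
    have := hsol b 0
    simp only [zero_mul, mul_zero, qPochInf_zero_left, one_mul] at this
    rw [hsymm, this, h00]
  have := hsol a b
  rw [h0, mul_one, ← mul_assoc] at this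
  exact this

/-! ### The weighted `q`-Chu–Vandermonde sum -/

lemma vandermondeSeries_succ (a b : ℂ) {z q : ℂ} (hq : ‖q‖ < 1) (hq0 : q ≠ 0) (hz : z ≠ 0)
    (h : ∀ m n : ℕ, z * q ^ m ≠ q ^ n) (k : ℕ) :
    vandermondeSeries q a b z 1 (k + 1) =
      (1 - a) * (1 - b) * z * q ^ k / (1 - q ^ (k + 1)) *
        vandermondeSeries q (a * q) (b * q) (z / q) 1 k := by
  have hzq : z - q ≠ 0 := sub_ne_zero.2 (by simpa using h 0 1)
  have hk := one_sub_pow_succ_ne_zero hq k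
  have hP : qPochInf (z / q) q = (1 - z / q) * qPochInf z q := by
    rw [qPochInf_eq_one_sub_mul _ hq, div_mul_cancel₀ _ hq0]
  have hz' : qPochInf z q ≠ 0 := qPochInf_ne_zero hq fun m => by simpa using h m 0
  unfold vandermondeSeries
  rw [show a * q * (z / q) = a * z by field_simp, show b * q * (z / q) = b * z by field_simp, hP]
  -- the term `n = 0` of the weighted series vanishes
  rw [← (add_left_injective 1).tsum_eq (f := fun n : ℕ => qPoch a q n * qPoch b q n /
    (qPoch q q n * qPoch (q / z) q n) * q ^ n * qKernel (1 * q ^ n) q (k + 1))]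
  · have e : ∀ n : ℕ, qPoch a q (n + 1) * qPoch b q (n + 1) /
        (qPoch q q (n + 1) * qPoch (q / z) q (n + 1)) * q ^ (n + 1) *
          qKernel (1 * q ^ (n + 1)) q (k + 1) =
        (-((1 - a) * (1 - b) * q ^ (k + 1) / ((1 - q / z) * (1 - q ^ (k + 1))))) *
          (qPoch (a * q) q n * qPoch (b * q) q n / (qPoch q q n * qPoch (q / (z / q)) q n) *
            q ^ n * qKernel (1 * q ^ n) q k) := by
      intro n
      have hn := one_sub_pow_succ_ne_zero hq n
      have h1 : 1 - q / z ≠ 0 := by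
        rw [one_sub_div hz]
        exact div_ne_zero hzq hz
      rw [qPoch_succ' a, qPoch_succ' b, qPoch_succ q, qPoch_succ' (q / z),
        show q / (z / q) = q / z * q by field_simp, one_mul, one_mul, pow_succ q n,
        qKernel_mul_succ _ hq]
      rw [pow_succ] at hn hk
      rw [mul_comm q (q ^ n), pow_succ q k]
      have h2 := qPoch_self_ne_zero hq n
      have h3 : qPoch (q / z * q) q n ≠ 0 := by
        refine qPoch_ne_zero (fun m hm => h 0 (m + 2) ?_) n
        field_simp at hm
        rw [pow_zero, mul_one, ← hm]
        ring
      generalize qPoch (q / z * q) q n = E at *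
      generalize 1 - q / z = F at *
      obtain ⟨D, hD⟩ : ∃ D, D = 1 - q ^ n * q := ⟨_, rfl⟩
      rw [show q ^ n * q - 1 = -(1 - q ^ n * q) by ring]
      rw [← hD] at hn ⊢
      generalize 1 - q ^ k * q = K at *
      field_simp
    simp only [e, tsum_mul_left]
    have h1 : 1 - z / q ≠ 0 := by
      rw [one_sub_div hq0, ← neg_sub]
      exact div_ne_zero (neg_ne_zero.2 hzq) hq0
    have key : q ^ (k + 1) / (1 - q / z) = -(z * q ^ k / (1 - z / q)) := by
      rw [one_sub_div hz, one_sub_div hq0, ← neg_sub z q]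
      field_simp
      ring
    rw [mul_comm (1 - q / z), ← div_div, mul_div_assoc, div_right_comm, mul_div_assoc, key]
    field_simp
  · intro n hn
    cases n with
    | zero => exact absurd (by simp [qKernel_one_succ]) hn
    | succ n => exact ⟨n, rfl⟩

lemma vandermondeSeries_dual_succ (a b : ℂ) {z q : ℂ} (hq : ‖q‖ < 1) (hq0 : q ≠ 0) (hz : z ≠ 0)
    (h : ∀ m n : ℕ, z * q ^ m ≠ q ^ n) (k : ℕ) :
    vandermondeSeries q (a * z) (b * z) z⁻¹ z (k + 1) =
      (1 - a) * (1 - b) * z * q ^ k / (1 - q ^ (k + 1)) *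
        vandermondeSeries q (a * q * (z / q)) (b * q * (z / q)) (z / q)⁻¹ (z / q) k := by
  have hk := one_sub_pow_succ_ne_zero hq k
  have hz1 : z - 1 ≠ 0 := sub_ne_zero.2 (by simpa using h 0 0)
  have hz2 : qPochInf (z⁻¹ * q) q ≠ 0 := qPochInf_ne_zero hq fun m hm => h 0 (m + 1) <| by
    field_simp at hm
    rw [pow_zero, mul_one, ← hm]
    ring
  unfold vandermondeSeries
  rw [show a * q * (z / q) = a * z by field_simp, show b * q * (z / q) = b * z by field_simp,
    mul_inv_cancel_right₀ hz, mul_inv_cancel_right₀ hz,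
    show a * z * (z / q)⁻¹ = a * q by field_simp, show b * z * (z / q)⁻¹ = b * q by field_simp,
    show (z / q)⁻¹ = z⁻¹ * q by field_simp, qPochInf_eq_one_sub_mul a hq,
    qPochInf_eq_one_sub_mul b hq, qPochInf_eq_one_sub_mul z⁻¹ hq,
    show q / z⁻¹ = z * q by field_simp, show q / (z⁻¹ * q) = z by field_simp]
  -- the two series agree term by term up to a constant factor
  have e : ∀ n : ℕ, qPoch (a * z) q n * qPoch (b * z) q n / (qPoch q q n * qPoch (z * q) q n) *
      q ^ n * qKernel (z * q ^ n) q (k + 1) =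
      ((z - 1) * q ^ k / (1 - q ^ (k + 1))) *
        (qPoch (a * z) q n * qPoch (b * z) q n / (qPoch q q n * qPoch z q n) *
          q ^ n * qKernel (z / q * q ^ n) q k) := by
    intro n
    have h1 := qPoch_self_ne_zero hq n
    have h2 : qPoch z q n ≠ 0 := qPoch_ne_zero (fun m => by simpa using h m 0) n
    have h3 : qPoch (z * q) q n ≠ 0 := qPoch_ne_zero
      (fun m => by simpa [pow_succ', mul_assoc] using h (m + 1) 0) n
    have h4 := qPoch_mul_one_sub z q n
    rw [show z * q ^ n = z / q * q ^ n * q by field_simp, qKernel_mul_succ _ hq,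
      show z / q * q ^ n * q = z * q ^ n by field_simp]
    have key : (z * q ^ n - 1) / qPoch (z * q) q n = (z - 1) / qPoch z q n := by
      rw [div_eq_div_iff h3 h2]
      linear_combination h4
    calc _ = qPoch (a * z) q n * qPoch (b * z) q n / qPoch q q n * q ^ n * q ^ k /
          (1 - q ^ (k + 1)) * qKernel (z / q * q ^ n) q k *
          ((z * q ^ n - 1) / qPoch (z * q) q n) := by ring
      _ = _ := by rw [key]; ring
  simp only [e, tsum_mul_left]
  rw [show 1 - z⁻¹ = (z - 1) / z by field_simp]
  field_simp

/-- The nonterminating `q`-Chu–Vandermonde sum with a weight; it is the coefficient of `x ^ k` in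
the three-term relation for `₂φ₁(a, b; a b z; q, x)`. -/
lemma vandermondeSeries_add_dual_weighted {q : ℂ} (hq : ‖q‖ < 1) (hq0 : q ≠ 0) (k : ℕ) :
    ∀ (a b : ℂ) {z : ℂ}, z ≠ 0 → (∀ m n : ℕ, z * q ^ m ≠ q ^ n) →
    vandermondeSeries q a b z 1 k + vandermondeSeries q (a * z) (b * z) z⁻¹ z k =
      qPoch a q k * qPoch b q k / qPoch q q k * z ^ k * qPochInf (a * b * z * q ^ k) q := by
  induction k with
  | zero =>
    intro a b z hz h
    have he : ∀ m : ℕ, q / z * q ^ m ≠ 1 := fun m hm => h 0 (m + 1) <| by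
      field_simp at hm
      rw [pow_zero, mul_one, ← hm]
      ring
    have hi : ∀ m : ℕ, z⁻¹ * q ^ m ≠ 1 := fun m hm => h 0 m <| by
      field_simp at hm
      rw [pow_zero, mul_one, ← hm]
    simpa using vandermondeSeries_add_dual a b 1 z hq hz he (fun m => by simpa using h m 0) hi
  | succ k ih =>
    intro a b z hz h
    have h' : ∀ m n : ℕ, z / q * q ^ m ≠ q ^ n := fun m n hm => h m (n + 1) <| by
      field_simp at hm
      rw [hm]
      ring
    rw [vandermondeSeries_succ a b hq hq0 hz h, vandermondeSeries_dual_succ a b hq hq0 hz h,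
      ← mul_add, ih (a * q) (b * q) (div_ne_zero hz hq0) h', qPoch_succ', qPoch_succ',
      qPoch_succ q, show a * q * (b * q) * (z / q) * q ^ k = a * b * z * q ^ (k + 1) by
        field_simp; ring, div_pow, mul_comm q (q ^ k), ← pow_succ q k]
    have hk := one_sub_pow_succ_ne_zero hq k
    have := qPoch_self_ne_zero hq k
    field_simp
    ring

/-! ### The first moment of the kernel -/

lemma exists_norm_qKernel_le {q : ℂ} (hq : ‖q‖ < 1) {r : ℝ} (hr : 0 < r) :
    ∃ C : ℝ, 0 < C ∧ ∀ u : ℂ, ‖u‖ ≤ r → ∀ k, ‖qKernel u q k‖ ≤ C * r ^ k := by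
  obtain ⟨C, h0, hC⟩ := exists_norm_inv_qPoch_le hq (mul_pow_ne_one hq hq)
  refine ⟨Real.exp (r⁻¹ / (1 - ‖q‖)) * C, by positivity, fun u hu k => ?_⟩
  have e : qKernel u q k = (∏ j ∈ Finset.range k, (u - q ^ j)) * (qPoch q q k)⁻¹ := by
    rw [qKernel, Finset.prod_div_distrib, qPoch, div_eq_mul_inv]
    simp only [pow_succ']
  have h1 : ‖∏ j ∈ Finset.range k, (u - q ^ j)‖ ≤ r ^ k * Real.exp (r⁻¹ / (1 - ‖q‖)) := by
    calc ‖∏ j ∈ Finset.range k, (u - q ^ j)‖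
        ≤ ∏ j ∈ Finset.range k, (r * (1 + r⁻¹ * ‖q‖ ^ j)) := by
          rw [norm_prod]
          refine Finset.prod_le_prod (fun _ _ => norm_nonneg _) fun j _ => ?_
          rw [mul_add, mul_inv_cancel_left₀ hr.ne', mul_one, ← norm_pow]
          exact (norm_sub_le _ _).trans (by gcongr)
      _ = r ^ k * ∏ j ∈ Finset.range k, (1 + r⁻¹ * ‖q‖ ^ j) := by
          rw [Finset.prod_mul_distrib, Finset.prod_const, Finset.card_range]
      _ ≤ _ := by
          gcongr
          exact prod_one_add_mul_pow_le (by positivity) (norm_nonneg q) hq k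
  rw [e, norm_mul]
  calc _ ≤ r ^ k * Real.exp (r⁻¹ / (1 - ‖q‖)) * C := by
        gcongr
        exact hC k
    _ = _ := by ring

lemma summable_nat_mul_geometric {r : ℝ} (hr : 0 ≤ r) (hr1 : r < 1) :
    Summable fun k : ℕ => (k : ℝ) * r ^ k := by
  simpa using summable_pow_mul_geometric_of_norm_lt_one 1
    (show ‖r‖ < 1 by rwa [Real.norm_of_nonneg hr])

lemma summable_qKernel {u q : ℂ} (hq : ‖q‖ < 1) (hu : ‖u‖ < 1) :
    Summable (qKernel u q) := by
  obtain ⟨r, hr, hr1⟩ := exists_between hu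
  have hr0 := (norm_nonneg u).trans_lt hr
  obtain ⟨C, -, hC⟩ := exists_norm_qKernel_le hq hr0
  exact Summable.of_norm_bounded ((summable_geometric_of_lt_one hr0.le hr1).mul_left C)
    fun k => hC u hr.le k

lemma summable_nat_mul_qKernel {u q : ℂ} (hq : ‖q‖ < 1) (hu : ‖u‖ < 1) :
    Summable fun k : ℕ => (k : ℂ) * qKernel u q k := by
  obtain ⟨r, hr, hr1⟩ := exists_between hu
  have hr0 := (norm_nonneg u).trans_lt hr
  obtain ⟨C, -, hC⟩ := exists_norm_qKernel_le hq hr0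
  refine Summable.of_norm_bounded ((summable_nat_mul_geometric hr0.le hr1).mul_left C)
    fun k => ?_
  rw [norm_mul, Complex.norm_natCast, mul_left_comm]
  have := hC u hr.le k
  gcongr

lemma tsum_qKernel {u q : ℂ} (hq : ‖q‖ < 1) (hu : ‖u‖ < 1) : ∑' k, qKernel u q k = 0 := by
  have hs := summable_qKernel hq hu
  -- the partial sums telescope
  have h1 : ∀ N : ℕ, (u - 1) * ∑ k ∈ Finset.range (N + 1), qKernel u q k =
      qKernel u q (N + 1) * (1 - q ^ (N + 1)) := by
    intro N
    induction N with
    | zero =>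
      have := one_sub_pow_succ_ne_zero hq 0
      simp [qKernel] at this ⊢
      field_simp
    | succ N ih =>
      have := one_sub_pow_succ_ne_zero hq (N + 1)
      rw [Finset.sum_range_succ, mul_add, ih, qKernel_succ u q (N + 1), mul_assoc _ (_ / _),
        div_mul_cancel₀ _ this]
      ring
  have h2 : Tendsto (fun N : ℕ => qKernel u q (N + 1) * (1 - q ^ (N + 1))) atTop
      (𝓝 (0 * (1 - 0))) :=
    ((tendsto_add_atTop_iff_nat 1).2 hs.tendsto_atTop_zero).mul (tendsto_const_nhds.sub
      ((tendsto_add_atTop_iff_nat 1).2 (tendsto_pow_atTop_nhds_zero_of_norm_lt_one hq)))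
  have h3 := ((tendsto_add_atTop_iff_nat 1).2 hs.hasSum.tendsto_sum_nat).const_mul (u - 1)
  have h4 := tendsto_nhds_unique (h3.congr h1) h2
  rw [zero_mul] at h4
  refine (mul_eq_zero.1 h4).resolve_left fun h => ?_
  rw [sub_eq_zero.1 h] at hu
  simp at hu

lemma tsum_nat_mul_qKernel_mul {u q : ℂ} (hq : ‖q‖ < 1) (hu : ‖u‖ < 1) :
    ∑' k : ℕ, (k : ℂ) * qKernel (u * q) q k = (1 - u) * ∑' k : ℕ, (k : ℂ) * qKernel u q k := by
  have huq : ‖u * q‖ < 1 := by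
    rw [norm_mul]
    exact mul_lt_one_of_nonneg_of_lt_one_left (norm_nonneg _) hu hq.le
  have shift : ∀ {v : ℂ}, ‖v‖ < 1 → HasSum (fun k : ℕ => ((k + 1 : ℕ) : ℂ) * qKernel v q (k + 1))
      (∑' k : ℕ, (k : ℂ) * qKernel v q k) := fun hv => by
    simpa using (hasSum_nat_add_iff' 1).2 (summable_nat_mul_qKernel hq hv).hasSum
  have h1 := shift hu
  have h2 := (summable_nat_mul_qKernel hq hu).hasSum.add (summable_qKernel hq hu).hasSum
  rw [tsum_qKernel hq hu, add_zero] at h2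
  -- `h1` and `h2` have equal sums, so a multiple of their difference can be added
  have h3 := (h1.mul_left (1 - u)).add ((h1.sub h2).mul_left u)
  rw [sub_self, mul_zero, add_zero] at h3
  refine (shift huq).unique (h3.congr_fun fun k => ?_)
  have := one_sub_pow_succ_ne_zero hq k
  rw [qKernel_mul_succ u hq, qKernel_succ]
  push_cast
  field_simp
  ring

lemma tendsto_tsum_nat_mul_qKernel {q : ℂ} (hq : ‖q‖ < 1) :
    Tendsto (fun u => ∑' k : ℕ, (k : ℂ) * qKernel u q k) (𝓝 0)
      (𝓝 (∑' k : ℕ, (k : ℂ) * qKernel 0 q k)) := by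
  obtain ⟨C, -, hC⟩ := exists_norm_qKernel_le hq (show (0 : ℝ) < 1 / 2 by norm_num)
  refine tendsto_tsum_of_dominated_convergence
    ((summable_nat_mul_geometric (r := 1 / 2) (by norm_num) (by norm_num)).mul_left C)
    (fun k => ?_) ?_
  · unfold qKernel
    exact Continuous.tendsto (by fun_prop) 0
  · filter_upwards [Metric.ball_mem_nhds (0 : ℂ) (show (0 : ℝ) < 1 / 2 by norm_num)] with u hu k
    rw [norm_mul, Complex.norm_natCast, mul_left_comm]
    have := hC u (mem_ball_zero_iff.1 hu).le k
    gcongr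

/-- The first moment `∑ k, k u ^ k (1 / u; q)_k / (q; q)_k`, which equals `-(q; q)_∞ / (u; q)_∞`.
The left-hand side is invariant under `u ↦ u q` and continuous at `0`, so it does not depend on
`u`, and `u = q` leaves a single term. -/
lemma tsum_nat_mul_qKernel {u q : ℂ} (hq : ‖q‖ < 1) (hu : ‖u‖ < 1) :
    (∑' k : ℕ, (k : ℂ) * qKernel u q k) * qPochInf u q = -qPochInf q q := by
  have main : ∀ {v : ℂ}, ‖v‖ < 1 → (∑' k : ℕ, (k : ℂ) * qKernel v q k) * qPochInf v q =
      ∑' k : ℕ, (k : ℂ) * qKernel 0 q k := by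
    intro v hv
    have h1 : ∀ N : ℕ, (∑' k : ℕ, (k : ℂ) * qKernel v q k) * qPoch v q N =
        ∑' k : ℕ, (k : ℂ) * qKernel (v * q ^ N) q k := by
      intro N
      induction N with
      | zero => simp
      | succ N ih =>
        have hvN : ‖v * q ^ N‖ < 1 := by
          rw [norm_mul, norm_pow]
          exact mul_lt_one_of_nonneg_of_lt_one_left (norm_nonneg _) hv
            (pow_le_one₀ (norm_nonneg _) hq.le)
        rw [qPoch_succ, ← mul_assoc, ih, pow_succ, ← mul_assoc, tsum_nat_mul_qKernel_mul hq hvN,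
          mul_comm]
    have h2 : Tendsto (fun N : ℕ => v * q ^ N) atTop (𝓝 0) := by
      simpa using (tendsto_pow_atTop_nhds_zero_of_norm_lt_one hq).const_mul v
    exact tendsto_nhds_unique ((tendsto_qPoch v hq).const_mul _)
      (((tendsto_tsum_nat_mul_qKernel hq).comp h2).congr fun N => (h1 N).symm)
  have hqq : ∑' k : ℕ, (k : ℂ) * qKernel q q k = -1 := by
    rw [tsum_eq_single 1]
    · have := one_sub_pow_succ_ne_zero hq 0
      simp [qKernel] at this ⊢
      field_simp
      ring
    · intro k hk
      match k, hk with
      | 0, _ => simp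
      | k + 2, _ =>
        rw [qKernel, Finset.prod_eq_zero (i := 1) (by simp) (by simp), mul_zero]
  rw [main hu, ← main hq, hqq, neg_one_mul]

lemma tsum_nat_mul_qKernel_one (q : ℂ) : ∑' k : ℕ, (k : ℂ) * qKernel 1 q k = 0 := by
  rw [tsum_eq_single 0 fun k hk => ?_]
  · simp
  · obtain ⟨k, rfl⟩ := Nat.exists_eq_succ_of_ne_zero hk
    simp [qKernel_one_succ]

lemma hasSum_tsum_swap {F : ℕ → ℕ → ℂ} (hF : Summable (Function.uncurry F)) :
    HasSum (fun k => ∑' n, F n k) (∑' n, ∑' k, F n k) := by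
  have h := hF.prod_symm.prod.hasSum
  simp only [Prod.swap, Function.uncurry] at h
  rwa [← hF.tsum_comm]

/-- The first moment in `k` of the weighted series, obtained by exchanging the two summations. -/
lemma hasSum_nat_mul_vandermondeSeries (a b : ℂ) {z y q : ℂ} {r : ℝ} (hq : ‖q‖ < 1)
    (he : ∀ m : ℕ, q / z * q ^ m ≠ 1) (hr : 0 < r) (hr1 : r < 1)
    (hy : ∀ n : ℕ, y * q ^ n = 1 ∨ ‖y * q ^ n‖ ≤ r) :
    HasSum (fun k : ℕ => (k : ℂ) * vandermondeSeries q a b z y k)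
      (qPochInf (a * z) q * qPochInf (b * z) q / qPochInf z q *
        ∑' n : ℕ, qPoch a q n * qPoch b q n / (qPoch q q n * qPoch (q / z) q n) * q ^ n *
          ∑' k : ℕ, (k : ℂ) * qKernel (y * q ^ n) q k) := by
  obtain ⟨C₁, h1, hC₁⟩ := exists_norm_coeff_le a b hq he
  obtain ⟨C₂, h2, hC₂⟩ := exists_norm_qKernel_le hq hr
  have hs : Summable (Function.uncurry fun n k : ℕ =>
      qPoch a q n * qPoch b q n / (qPoch q q n * qPoch (q / z) q n) * q ^ n *
        ((k : ℂ) * qKernel (y * q ^ n) q k)) := by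
    have hb : Summable fun p : ℕ × ℕ => (C₁ * ‖q‖ ^ p.1) * (C₂ * ((p.2 : ℝ) * r ^ p.2)) :=
      Summable.mul_of_nonneg ((summable_geometric_of_lt_one (norm_nonneg q) hq).mul_left C₁)
        ((summable_nat_mul_geometric hr.le hr1).mul_left C₂)
        (fun n => by positivity) (fun k => by positivity)
    refine Summable.of_norm_bounded hb fun ⟨n, k⟩ => ?_
    have e1 := hC₁ a le_rfl n
    have e2 : ‖(k : ℂ) * qKernel (y * q ^ n) q k‖ ≤ C₂ * (k * r ^ k) := by
      rw [norm_mul, Complex.norm_natCast, mul_left_comm]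
      rcases hy n with h | h
      · cases k with
        | zero => simp
        | succ k =>
          rw [h, qKernel_one_succ, norm_zero, mul_zero]
          positivity
      · have := hC₂ _ h k
        gcongr
    simp only [Function.uncurry]
    rw [norm_mul, norm_mul (_ / _), norm_pow]
    gcongr
  have h3 := hasSum_tsum_swap hs
  simp only [tsum_mul_left] at h3
  refine (h3.mul_left (qPochInf (a * z) q * qPochInf (b * z) q / qPochInf z q)).congr_fun
    fun k => ?_
  rw [vandermondeSeries, mul_left_comm, ← tsum_mul_left]
  congr 1
  exact tsum_congr fun n => by ring

/-! ### The derivative formula -/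

lemma qPochInf_zero_right (a : ℂ) : qPochInf a 0 = 1 - a := by
  rw [qPochInf_eq_one_sub_mul a (by simp), mul_zero, qPochInf_zero_left, mul_one]

lemma qPoch_zero_right_succ (a : ℂ) (n : ℕ) : qPoch a 0 (n + 1) = 1 - a := by
  rw [qPoch_succ', mul_zero, qPoch_zero_left, mul_one]

/-- The formula for `q ≠ 0`, with `c = a b z`. -/
lemma tsum_nat_mul_coeff (a b : ℂ) {z q : ℂ} (hq : ‖q‖ < 1) (hq0 : q ≠ 0) (hz : z ≠ 0)
    (hz1 : ‖z‖ < 1) (hc : ∀ m : ℕ, a * b * z * q ^ m ≠ 1) (he : ∀ m : ℕ, q / z * q ^ m ≠ 1) :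
    ∑' n : ℕ, (n : ℂ) * (qPoch a q n * qPoch b q n / (qPoch q q n * qPoch (a * b * z) q n)) *
        z ^ n =
    -(qPochInf (b * z) q * qPochInf (a * z) q / (qPochInf (a * b * z) q * qPochInf z q)) *
        ∑' n : ℕ, qPoch a q (n + 1) * qPoch b q (n + 1) / qPoch (q / z) q (n + 1)
          * (q ^ (n + 1) / (1 - q ^ (n + 1)))
      - qPochInf a q * qPochInf b q * qPochInf q q /
          (qPochInf (a * b * z) q * qPochInf z⁻¹ q * qPochInf (z * q) q) *
        ∑' n : ℕ, qPoch (b * z) q n * qPoch (a * z) q n / qPoch q q n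
          * (q ^ n / (1 - z * q ^ n)) := by
  have hz0 : ∀ m : ℕ, z * q ^ m ≠ 1 := mul_pow_ne_one hq hz1
  -- `z` is no integral power of `q`
  have h : ∀ m n : ℕ, z * q ^ m ≠ q ^ n := by
    intro m n hmn
    rcases le_or_gt n m with hle | hlt
    · obtain ⟨d, rfl⟩ := Nat.exists_eq_add_of_le hle
      refine hz0 d (mul_right_cancel₀ (pow_ne_zero n hq0) ?_)
      linear_combination hmn
    · obtain ⟨d, rfl⟩ := Nat.exists_eq_add_of_lt hlt
      have : z = q ^ (d + 1) := mul_right_cancel₀ (pow_ne_zero m hq0) (hmn.trans (by ring))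
      refine he d ?_
      rw [this, pow_succ']
      field_simp
  have he' : ∀ m : ℕ, q / z⁻¹ * q ^ m ≠ 1 := fun m => by
    rw [div_inv_eq_mul]
    simpa [pow_succ', mul_assoc, mul_comm, mul_left_comm] using hz0 (m + 1)
  have hpow : ∀ n : ℕ, ‖q ^ (n + 1)‖ < 1 := fun n => by
    rw [norm_pow]
    exact pow_lt_one₀ (norm_nonneg _) hq (by simp)
  have hzpow : ∀ n : ℕ, ‖z * q ^ n‖ ≤ ‖z‖ := fun n => by
    rw [norm_mul, norm_pow]
    exact mul_le_of_le_one_right (norm_nonneg _) (pow_le_one₀ (norm_nonneg _) hq.le)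
  have s1 := hasSum_nat_mul_vandermondeSeries a b (y := 1) hq he (norm_pos_iff.2 hq0) hq
    fun n => by
      cases n with
      | zero => left; simp
      | succ n =>
        right
        rw [one_mul, pow_succ', norm_mul, norm_pow]
        exact mul_le_of_le_one_right (norm_nonneg _) (pow_le_one₀ (norm_nonneg _) hq.le)
  have s2 := hasSum_nat_mul_vandermondeSeries (a * z) (b * z) (y := z) hq he'
    (norm_pos_iff.2 hz) hz1 fun n => Or.inr (hzpow n)
  rw [mul_inv_cancel_right₀ hz, mul_inv_cancel_right₀ hz] at s2
  -- the first moments of the two weighted series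
  have e1 : ∑' n : ℕ, qPoch a q n * qPoch b q n / (qPoch q q n * qPoch (q / z) q n) * q ^ n *
        ∑' k : ℕ, (k : ℂ) * qKernel (1 * q ^ n) q k =
      -∑' n : ℕ, qPoch a q (n + 1) * qPoch b q (n + 1) / qPoch (q / z) q (n + 1)
          * (q ^ (n + 1) / (1 - q ^ (n + 1))) := by
    rw [← (add_left_injective 1).tsum_eq (f := fun n : ℕ => qPoch a q n * qPoch b q n /
      (qPoch q q n * qPoch (q / z) q n) * q ^ n * ∑' k : ℕ, (k : ℂ) * qKernel (1 * q ^ n) q k),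
      ← tsum_neg]
    · refine tsum_congr fun n => ?_
      have m1 := tsum_nat_mul_qKernel hq (hpow n)
      rw [← qPoch_mul_qPochInf q hq n, ← neg_mul, ← pow_succ'] at m1
      have m2 := mul_right_cancel₀ (qPochInf_ne_zero hq (mul_pow_ne_one hq (hpow n))) m1
      have := qPoch_self_ne_zero hq n
      have := one_sub_pow_succ_ne_zero hq n
      have := qPoch_ne_zero he (n + 1)
      simp only [one_mul]
      rw [m2, qPoch_succ q, ← pow_succ']
      field_simp
    · intro n hn
      cases n with
      | zero => exact absurd (by simp [tsum_nat_mul_qKernel_one]) hn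
      | succ n => exact ⟨n, rfl⟩
  have e2 : ∑' n : ℕ, qPoch (a * z) q n * qPoch (b * z) q n /
        (qPoch q q n * qPoch (q / z⁻¹) q n) * q ^ n *
        ∑' k : ℕ, (k : ℂ) * qKernel (z * q ^ n) q k =
      -(qPochInf q q / qPochInf (z * q) q) *
        ∑' n : ℕ, qPoch (b * z) q n * qPoch (a * z) q n / qPoch q q n
          * (q ^ n / (1 - z * q ^ n)) := by
    rw [← tsum_mul_left]
    refine tsum_congr fun n => ?_
    have m1 := tsum_nat_mul_qKernel hq ((hzpow n).trans_lt hz1)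
    have m2 := qPoch_mul_qPochInf z hq n
    have m3 := qPochInf_eq_one_sub_mul z hq
    have m4 := qPoch_mul_one_sub z q n
    have h1 := qPoch_self_ne_zero hq n
    have h2 : 1 - z * q ^ n ≠ 0 := sub_ne_zero.2 (hz0 n).symm
    have h3 : qPoch (z * q) q n ≠ 0 := qPoch_ne_zero
      (fun m => by simpa [pow_succ', mul_assoc] using h (m + 1) 0) n
    have h4 : qPochInf (z * q) q ≠ 0 := qPochInf_ne_zero hq
      fun m => by simpa [pow_succ', mul_assoc] using h (m + 1) 0
    have h5 : qPochInf (z * q ^ n) q ≠ 0 :=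
      qPochInf_ne_zero hq (mul_pow_ne_one hq ((hzpow n).trans_lt hz1))
    have h6 : 1 - z ≠ 0 := sub_ne_zero.2 (by simpa using (hz0 0).symm)
    rw [div_inv_eq_mul, mul_comm q z]
    -- `(z q; q)_n (z q ^ n; q)_∞ = (1 - z q ^ n) (z q; q)_∞`
    have m5 : qPoch (z * q) q n * qPochInf (z * q ^ n) q =
        (1 - z * q ^ n) * qPochInf (z * q) q := by
      refine mul_left_cancel₀ h6 ?_
      linear_combination qPochInf (z * q ^ n) q * m4 + (1 - z * q ^ n) * m2 + (1 - z * q ^ n) * m3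
    have m6 : (∑' k : ℕ, (k : ℂ) * qKernel (z * q ^ n) q k) / qPoch (z * q) q n =
        -(qPochInf q q / qPochInf (z * q) q) / (1 - z * q ^ n) := by
      rw [eq_div_of_mul_eq h5 m1, div_div, mul_comm (qPochInf (z * q ^ n) q), m5]
      field_simp
    calc _ = qPoch (a * z) q n * qPoch (b * z) q n / qPoch q q n * q ^ n *
          ((∑' k : ℕ, (k : ℂ) * qKernel (z * q ^ n) q k) / qPoch (z * q) q n) := by ring
      _ = _ := by rw [m6]; ring
  rw [e1] at s1
  rw [e2] at s2
  have hcne := qPochInf_ne_zero hq hc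
  have s := (s1.add s2).div_const (qPochInf (a * b * z) q)
  have s' : HasSum (fun n : ℕ => (n : ℂ) * (qPoch a q n * qPoch b q n /
      (qPoch q q n * qPoch (a * b * z) q n)) * z ^ n) _ := s.congr_fun fun k => by
    rw [← mul_add, vandermondeSeries_add_dual_weighted hq hq0 k a b hz h]
    have h1 := qPoch_ne_zero hc k
    rw [← qPoch_mul_qPochInf (a * b * z) hq k] at hcne ⊢
    have := right_ne_zero_of_mul hcne
    have := qPoch_self_ne_zero hq k
    field_simp
  rw [s'.tsum_eq]
  ring

/-- The formula for `q = 0`, where all the series are elementary. -/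
lemma tsum_nat_mul_coeff_zero (a b : ℂ) {z : ℂ} (hz : z ≠ 0) (hz1 : ‖z‖ < 1)
    (hc : a * b * z ≠ 1) :
    ∑' n : ℕ, (n : ℂ) * (qPoch a 0 n * qPoch b 0 n / (qPoch 0 0 n * qPoch (a * b * z) 0 n)) *
        z ^ n =
    -(qPochInf (b * z) 0 * qPochInf (a * z) 0 / (qPochInf (a * b * z) 0 * qPochInf z 0)) *
        ∑' n : ℕ, qPoch a 0 (n + 1) * qPoch b 0 (n + 1) / qPoch (0 / z) 0 (n + 1)
          * (0 ^ (n + 1) / (1 - 0 ^ (n + 1)))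
      - qPochInf a 0 * qPochInf b 0 * qPochInf 0 0 /
          (qPochInf (a * b * z) 0 * qPochInf z⁻¹ 0 * qPochInf (z * 0) 0) *
        ∑' n : ℕ, qPoch (b * z) 0 n * qPoch (a * z) 0 n / qPoch 0 0 n
          * (0 ^ n / (1 - z * 0 ^ n)) := by
  have h1 : 1 - z ≠ 0 := by
    refine sub_ne_zero.2 fun h => ?_
    rw [← h, norm_one] at hz1
    exact lt_irrefl _ hz1
  have h2 : 1 - a * b * z ≠ 0 := sub_ne_zero.2 hc.symm
  have e1 : ∀ n : ℕ, (n : ℂ) * (qPoch a 0 n * qPoch b 0 n /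
      (qPoch 0 0 n * qPoch (a * b * z) 0 n)) * z ^ n =
      (1 - a) * (1 - b) / (1 - a * b * z) * (n * z ^ n) := by
    intro n
    cases n with
    | zero => simp
    | succ n =>
      simp only [qPoch_zero_right_succ]
      ring
  rw [tsum_congr e1, tsum_mul_left, tsum_coe_mul_geometric_of_norm_lt_one hz1,
    tsum_eq_single (f := fun n : ℕ => qPoch (b * z) 0 n * qPoch (a * z) 0 n / qPoch 0 0 n
          * (0 ^ n / (1 - z * 0 ^ n))) 0 fun n hn => by simp [hn]]
  have h3 : z - 1 ≠ 0 := by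
    rw [← neg_sub]
    exact neg_ne_zero.2 h1
  simp only [qPochInf_zero_right, qPoch_zero, ne_eq, Nat.add_eq_zero_iff, one_ne_zero, and_false,
    not_false_eq_true, zero_pow, zero_div, mul_zero, tsum_zero, pow_zero, sub_zero, mul_one,
    one_mul, zero_sub, div_one]
  rw [show 1 - z⁻¹ = (z - 1) / z by field_simp, show z - 1 = -(1 - z) by ring]
  field_simp

lemma summable_nat_mul_coeff (a b : ℂ) {e z q : ℂ} (hq : ‖q‖ < 1) (hz1 : ‖z‖ < 1)
    (he : ∀ m : ℕ, e * q ^ m ≠ 1) :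
    Summable fun n : ℕ =>
      (n : ℂ) * (qPoch a q n * qPoch b q n / (qPoch q q n * qPoch e q n)) * z ^ n := by
  obtain ⟨C, -, hC⟩ := exists_norm_coeff_le a b hq he
  refine Summable.of_norm_bounded
    ((summable_nat_mul_geometric (norm_nonneg z) hz1).mul_left C) fun n => ?_
  rw [norm_mul, norm_mul, Complex.norm_natCast, norm_pow, mul_left_comm, ← mul_assoc]
  have := hC a le_rfl n
  gcongr

lemma summable_coeff_div_one_sub_pow (a b : ℂ) {e q : ℂ} (hq : ‖q‖ < 1)
    (he : ∀ m : ℕ, e * q ^ m ≠ 1) :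
    Summable fun n : ℕ => qPoch a q (n + 1) * qPoch b q (n + 1) / qPoch e q (n + 1)
        * (q ^ (n + 1) / (1 - q ^ (n + 1))) := by
  have hs := (summable_nat_add_iff 1).2 (summable_coeff_mul_pow a b hq he)
  refine Summable.of_norm_bounded (hs.norm.mul_right (Real.exp (‖q‖ / (1 - ‖q‖)))) fun n => ?_
  have h1 := qPoch_self_ne_zero hq n
  have h2 := one_sub_pow_succ_ne_zero hq n
  have e1 : qPoch a q (n + 1) * qPoch b q (n + 1) / qPoch e q (n + 1)
        * (q ^ (n + 1) / (1 - q ^ (n + 1))) =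
      qPoch a q (n + 1) * qPoch b q (n + 1) / (qPoch q q (n + 1) * qPoch e q (n + 1)) *
        q ^ (n + 1) * qPoch q q n := by
    rw [qPoch_succ q, ← pow_succ']
    field_simp
  rw [e1, norm_mul]
  gcongr
  exact norm_qPoch_le q hq n

lemma summable_coeff_div_one_sub_mul_pow (a b : ℂ) {z q : ℂ} (hq : ‖q‖ < 1) (hz1 : ‖z‖ < 1) :
    Summable fun n : ℕ => qPoch a q n * qPoch b q n / qPoch q q n * (q ^ n / (1 - z * q ^ n)) := by
  have hz0 : ∀ m : ℕ, z * q ^ m ≠ 1 := mul_pow_ne_one hq hz1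
  have hz0' : ∀ m : ℕ, z * q * q ^ m ≠ 1 := fun m => by
    simpa [pow_succ', mul_assoc] using hz0 (m + 1)
  have hs := summable_coeff_mul_pow a b hq hz0'
  refine Summable.of_norm_bounded
    (hs.norm.mul_right (Real.exp (‖z‖ / (1 - ‖q‖)) / ‖1 - z‖)) fun n => ?_
  have h1 : 1 - z ≠ 0 := sub_ne_zero.2 (by simpa using (hz0 0).symm)
  have h2 : 1 - z * q ^ n ≠ 0 := sub_ne_zero.2 (hz0 n).symm
  have h3 := qPoch_ne_zero hz0' n
  have e2 : 1 / (1 - z * q ^ n) = 1 / qPoch (z * q) q n * (qPoch z q n / (1 - z)) := by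
    have := qPoch_mul_one_sub z q n
    field_simp
    linear_combination this
  have e1 : qPoch a q n * qPoch b q n / qPoch q q n * (q ^ n / (1 - z * q ^ n)) =
      qPoch a q n * qPoch b q n / (qPoch q q n * qPoch (z * q) q n) * q ^ n *
        (qPoch z q n / (1 - z)) := by
    rw [← mul_one_div (q ^ n), e2]
    ring
  rw [e1, norm_mul, norm_div (qPoch z q n)]
  gcongr
  exact norm_qPoch_le z hq n

theorem mainTheorem11 (q a b c : ℂ) (hq : ‖q‖ < 1)
    (ha : a ≠ 0) (hb : b ≠ 0) (hc : c ≠ 0)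
    (hconv : ‖c / (a * b)‖ < 1)
    (hcq : ∀ m : ℕ, c * q ^ m ≠ 1)
    (habc : ∀ m : ℕ, 1 ≤ m → a * b / c * q ^ m ≠ 1) :
    (Summable fun n : ℕ =>
      (n : ℂ) * (qPoch a q n * qPoch b q n / (qPoch q q n * qPoch c q n)) * (c / (a * b)) ^ n) ∧
    (Summable fun n : ℕ =>
      qPoch a q (n + 1) * qPoch b q (n + 1) / qPoch (q * a * b / c) q (n + 1)
        * (q ^ (n + 1) / (1 - q ^ (n + 1)))) ∧
    (Summable fun n : ℕ =>
      qPoch (c / a) q n * qPoch (c / b) q n / qPoch q q n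
        * (q ^ n / (1 - c * q ^ n / (a * b)))) ∧
    ∑' n : ℕ,
      (n : ℂ) * (qPoch a q n * qPoch b q n / (qPoch q q n * qPoch c q n)) * (c / (a * b)) ^ n =
    -(qPochInf (c / a) q * qPochInf (c / b) q / (qPochInf c q * qPochInf (c / (a * b)) q)) *
        ∑' n : ℕ, qPoch a q (n + 1) * qPoch b q (n + 1) / qPoch (q * a * b / c) q (n + 1)
          * (q ^ (n + 1) / (1 - q ^ (n + 1)))
      - qPochInf a q * qPochInf b q * qPochInf q q /
          (qPochInf c q * qPochInf (a * b / c) q * qPochInf (c * q / (a * b)) q) *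
        ∑' n : ℕ, qPoch (c / a) q n * qPoch (c / b) q n / qPoch q q n
          * (q ^ n / (1 - c * q ^ n / (a * b))) := by
  obtain ⟨z, hz⟩ : ∃ z, z = c / (a * b) := ⟨_, rfl⟩
  have hz0 : z ≠ 0 := by rw [hz]; exact div_ne_zero hc (mul_ne_zero ha hb)
  have ec : c = a * b * z := by rw [hz]; field_simp
  have e1 : q * a * b / c = q / z := by rw [ec]; field_simp
  have e2 : c / a = b * z := by rw [ec]; field_simp
  have e3 : c / b = a * z := by rw [ec]; field_simp
  have e4 : a * b / c = z⁻¹ := by rw [ec]; field_simp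
  have e5 : ∀ x : ℂ, c * x / (a * b) = z * x := fun x => by rw [ec]; field_simp
  simp only [e1, e2, e3, e4, e5, ← hz]
  rw [← hz] at hconv
  rw [e4] at habc
  clear e1 e2 e3 e4 e5 hz
  subst ec
  have he : ∀ m : ℕ, q / z * q ^ m ≠ 1 := fun m => by
    have := habc (m + 1) (by simp)
    rwa [pow_succ', ← mul_assoc, inv_mul_eq_div] at this
  refine ⟨summable_nat_mul_coeff a b hq hconv hcq, summable_coeff_div_one_sub_pow a b hq he,
    summable_coeff_div_one_sub_mul_pow _ _ hq hconv, ?_⟩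
  rcases eq_or_ne q 0 with rfl | hq0
  · exact tsum_nat_mul_coeff_zero a b hz0 hconv (by simpa using hcq 0)
  · exact tsum_nat_mul_coeff a b hq hq0 hz0 hconv hcq he
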